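/- Let $A$ be a standard Borel space, and for a measurable space $E$ let $\Pr E$ be the set of probability measures on $E$, with the $\sigma$-algebra generated by the evaluations $m\mapsto m(B)$, $B\subseteq E$ measurable. Let $S_{\mathbb N}$ be the group of permutations of $\mathbb N$ that fix all but finitely many elements, acting on $A^{\mathbb N}$ by $T^\sigma((x_i)_i)=(x_{\sigma(i)})_i$. An exchangeable random measure on $A^{\mathbb N}$ is a random variable $\mu$ with values in $\Pr(A^{\mathbb N})$ such that $\mu$ and $T^\sigma_*\mu$ have the same law for every $\sigma\in S_{\mathbb N}$. A sequence $(X_i)_{i\in\mathbb N}$ of random variables is exchangeable if $(X_{\sigma(i)})_i$ and $(X_i)_i$ have the same law for every $\sigma\in S_{\mathbb N}$. An exchangeable random product measure on $A^{\mathbb N}$ is a random measure of the form $\bigotimes_i m_i$, where $(m_i)_{i\in\mathbb N}$ is an exchangeable sequence of $(\Pr A)$-valued random variables. Let $B([0,1),\Pr A)$ be the space of Lebesgue-a.e. equivalence classes of measurable functions $f:[0,1)\to\Pr A$, with the $\sigma$-algebra generated by the functionals $f\mapsto\int_0^1\varphi(t)f(t,B)\,dt$ for $\varphi\in L^\infty[0,1)$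 and measurable $B\subseteq A$. **Theorem B.** Let $\mu$ be an exchangeable random measure on $A^{\mathbb N}$. Then there is, on some probability space, an exchangeable sequence $(\lambda_i)_{i\in\mathbb N}$ of random variables with values in $B([0,1),\Pr A)$ such that $$\mu(\cdot)\ \stackrel{\mathrm{law}}{=}\ \int_0^1\Big(\bigotimes_{i\in\mathbb N}\lambda_i(t,\cdot)\Big)\,dt .$$ Moreover, the classes $\lambda_i$ can be represented by functions $\lambda_i(\omega,t,\cdot)\in\Pr A$, jointly measurable in $(\omega,t)$, such that for every $t\in[0,1)$ the random measure $\bigotimes_{i\in\mathbb N}\lambda_i(t,\cdot)$ is an exchangeable random product measure. In this sense every exchangeable random measure on $A^{\mathbb N}$ is a mixture of exchangeable random product measures. -/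

import Mathlib

open MeasureTheory ProbabilityTheory

noncomputable section

namespace ERM

/-! ### Exchangeability -/

/-- `S_ℕ`: the permutations of `ℕ` which fix all but finitely many elements. -/
def IsFinitary (σ : Equiv.Perm ℕ) : Prop := {i : ℕ | σ i ≠ i}.Finite

/-- A sequence of random variables on `(Ω, P)` is exchangeable if each of its rearrangements by
an element of `S_ℕ` has the same (joint) law. -/
def IsExchangeableSeq {Ω E : Type*} [MeasurableSpace Ω] [MeasurableSpace E] (P : Measure Ω)
    (X : ℕ → Ω → E) : Prop :=
  (∀ i, Measurable (X i)) ∧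
    ∀ σ : Equiv.Perm ℕ, IsFinitary σ →
      IdentDistrib (fun ω i => X (σ i) ω) (fun ω i => X i ω) P P

section

variable {A : Type*} [MeasurableSpace A]

/-- The action `T^σ x = (x_{σ(i)})_i` on sequences. -/
def permute (σ : Equiv.Perm ℕ) (x : ℕ → A) : ℕ → A := fun i => x (σ i)

theorem measurable_permute (σ : Equiv.Perm ℕ) : Measurable (permute (A := A) σ) :=
  measurable_pi_lambda _ fun i => measurable_pi_apply (σ i)

/-- An exchangeable random measure on `A^ℕ`: a random variable `μ` with values in `Pr (A^ℕ)`
having the same law as its image `T^σ_* μ`, for every `σ ∈ S_ℕ`. -/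
def IsERM {Ω : Type*} [MeasurableSpace Ω] (P : Measure Ω)
    (μ : Ω → ProbabilityMeasure (ℕ → A)) : Prop :=
  Measurable μ ∧
    ∀ σ : Equiv.Perm ℕ, IsFinitary σ →
      IdentDistrib μ (fun ω => (μ ω).map (measurable_permute σ).aemeasurable) P P

/-- The product measure `⨂ i, m i` on `A^ℕ`. -/
def prodMeasure (m : ℕ → ProbabilityMeasure A) : ProbabilityMeasure (ℕ → A) :=
  ⟨Measure.infinitePi fun i => (m i : Measure A), inferInstance⟩

/-- An exchangeable random product measure: the product of the terms of an exchangeable sequence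
of random variables with values in `Pr A`. -/
def IsERPM {Ω : Type*} [MeasurableSpace Ω] (P : Measure Ω)
    (ν : Ω → ProbabilityMeasure (ℕ → A)) : Prop :=
  ∃ m : ℕ → Ω → ProbabilityMeasure A, IsExchangeableSeq P m ∧
    ∀ ω, ν ω = prodMeasure fun i => m i ω

theorem measurable_prodMeasure :
    Measurable (prodMeasure : (ℕ → ProbabilityMeasure A) → ProbabilityMeasure (ℕ → A)) := by
  refine Measurable.subtype_mk ?_
  refine Measurable.measure_of_isPiSystem_of_isProbabilityMeasure
    (generateFrom_squareCylinders (α := fun _ : ℕ => A)).symm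
    (isPiSystem_squareCylinders (fun _ => MeasurableSpace.isPiSystem_measurableSet)
      fun _ => MeasurableSet.univ) ?_
  rintro _ ⟨s, t, ht, rfl⟩
  have ht' : ∀ i ∈ s, MeasurableSet (t i) := fun i _ => ht i (Set.mem_univ i)
  simp only [Measure.infinitePi_pi _ ht']
  exact Finset.measurable_prod _ fun i hi =>
    (Measure.measurable_coe (ht' i hi)).comp
      (measurable_subtype_coe.comp (measurable_pi_apply i))

end

/-! ### The unit interval `[0,1)` and mixtures over it -/

/-- The interval `[0,1)`. -/
abbrev I01 : Type := Set.Ico (0 : ℝ) 1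

/-- Lebesgue measure on `[0,1)`. -/
def leb : Measure I01 := (volume : Measure ℝ).comap Subtype.val

instance : IsProbabilityMeasure leb :=
  ⟨by
    rw [leb, (MeasurableEmbedding.subtype_coe measurableSet_Ico).comap_apply, Set.image_univ,
      Subtype.range_coe, Real.volume_Ico]
    simp⟩

/-- The mixture `∫₀¹ ν_t dt` of a measurable family of probability measures. -/
def mix {E : Type*} [MeasurableSpace E] (ν : I01 → ProbabilityMeasure E) (hν : Measurable ν) :
    ProbabilityMeasure E :=
  ⟨leb.bind fun t => (ν t : Measure E),
    ⟨by
      have h : Measurable fun t => (ν t : Measure E) := measurable_subtype_coe.comp hν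
      rw [Measure.bind_apply MeasurableSet.univ h.aemeasurable]
      simp⟩⟩

theorem mix_apply {E : Type*} [MeasurableSpace E] (ν : I01 → ProbabilityMeasure E)
    (hν : Measurable ν) {s : Set E} (hs : MeasurableSet s) :
    (mix ν hν : Measure E) s = ∫⁻ t, (ν t : Measure E) s ∂leb :=
  Measure.bind_apply hs (measurable_subtype_coe.comp hν).aemeasurable

section

variable (A : Type*) [MeasurableSpace A]

/-- Measurable functions `[0,1) → Pr A`. -/
abbrev MeasFun : Type _ := {f : I01 → ProbabilityMeasure A // Measurable f}

/-- Equality Lebesgue-almost everywhere. -/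
def aeSetoid : Setoid (MeasFun A) where
  r f g := f.1 =ᵐ[leb] g.1
  iseqv := ⟨fun _ => Filter.EventuallyEq.rfl, fun h => h.symm, fun h k => h.trans k⟩

/-- `B([0,1), Pr A)`: the space of Lebesgue-a.e. equivalence classes of measurable functions
`[0,1) → Pr A`. -/
def BSpace : Type _ := Quotient (aeSetoid A)

variable {A}

/-- The class of a measurable function. -/
def BSpace.mk (f : I01 → ProbabilityMeasure A) (hf : Measurable f) : BSpace A :=
  Quotient.mk (aeSetoid A) ⟨f, hf⟩

/-- The functional `f ↦ ∫₀¹ φ(t) f(t, s) dt` on `B([0,1), Pr A)`. -/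
def BSpace.functional (φ : I01 → ℝ) (s : Set A) : BSpace A → ℝ :=
  Quotient.lift (fun f : MeasFun A => ∫ t, φ t * (f.1 t : Measure A).real s ∂leb)
    fun f g (h : f.1 =ᵐ[leb] g.1) => integral_congr_ae <| by
      filter_upwards [h] with t ht
      rw [ht]

/-- The σ-algebra on `B([0,1), Pr A)` generated by the functionals `f ↦ ∫₀¹ φ(t) f(t, s) dt`,
for `φ ∈ L^∞[0,1)` and measurable `s ⊆ A`. -/
instance : MeasurableSpace (BSpace A) :=
  ⨆ (φ : I01 → ℝ) (_ : MemLp φ ⊤ leb) (s : Set A) (_ : MeasurableSet s),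
    MeasurableSpace.comap (BSpace.functional φ s) inferInstance

/-- A representative of a class. -/
def BSpace.rep (f : BSpace A) : I01 → ProbabilityMeasure A := (Quotient.out f).1

theorem BSpace.measurable_rep (f : BSpace A) : Measurable f.rep := (Quotient.out f).2

theorem BSpace.rep_mk (f : I01 → ProbabilityMeasure A) (hf : Measurable f) :
    (BSpace.mk f hf).rep =ᵐ[leb] f :=
  Quotient.mk_out (s := aeSetoid A) (⟨f, hf⟩ : MeasFun A)

/-- `∫₀¹ ⨂ i, f i (t, ·) dt` for a sequence of measurable functions `f i : [0,1) → Pr A`. -/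
def mixProdFun (f : ℕ → I01 → ProbabilityMeasure A) (hf : ∀ i, Measurable (f i)) :
    ProbabilityMeasure (ℕ → A) :=
  mix (fun t => prodMeasure fun i => f i t)
    (measurable_prodMeasure.comp (measurable_pi_lambda _ hf))

/-- `∫₀¹ ⨂ i, l i (t, ·) dt` for a sequence of elements `l i` of `B([0,1), Pr A)`. It does not
depend on the choice of representatives: see `mixProd_mk`. -/
def mixProd (l : ℕ → BSpace A) : ProbabilityMeasure (ℕ → A) :=
  mixProdFun (fun i => (l i).rep) fun i => (l i).measurable_rep

theorem mixProd_mk (f : ℕ → I01 → ProbabilityMeasure A) (hf : ∀ i, Measurable (f i)) :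
    mixProd (fun i => BSpace.mk (f i) (hf i)) = mixProdFun f hf := by
  apply Subtype.ext
  refine Measure.bind_congr_right ?_
  have h : ∀ᵐ t ∂leb, ∀ i, (BSpace.mk (f i) (hf i)).rep t = f i t :=
    ae_all_iff.2 fun i => BSpace.rep_mk (f i) (hf i)
  filter_upwards [h] with t ht
  simp only [ht]

end

end ERM

end

namespace ERM

open Set Filter Topology
open scoped ENNReal

/-! ### Measures on sequence spaces and product kernels -/

section Sequences

variable {S X : Type*} [MeasurableSpace S] [MeasurableSpace X]

/-! Let `Q` be the law of the random measure. Given the measure, sample from it independently an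
array of infinitely many rows and one additional row. Invariance of `Q` makes the columns, each an
array column with its additional entry, an exchangeable sequence. By de Finetti
(`lintegral_powKernel_headKernel`, resting on `headKernel_odd_ae_eq_tail`) they are i.i.d. with law
`θ w` given a variable `w`. Disintegrate `θ w` into the law `b w` of an array column `c` and the
conditional law `κ (w, c)` of the additional entry. Given `w` and the array columns `c i`, the
additional row has law `⨂ i, κ (w, c i)`. The `c i` depend on `w` only through `b w`, so given `b`
and the `c i` the variable `w` can be resampled as `φ b t` with `t` uniform
(`exists_randomization`), and the conditional law of the additional row becomes `ν = ∫ ⨂ i, κ (φ b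
t, c i) dt`. Its factors are functions of `b`, `t` and `c i`, where the `c i` are i.i.d. given `b`;
this gives exchangeability, both of the classes and at each fixed `t`.

It remains to see that `ν` has law `Q` (`exists_mixture`). By the law of large numbers the array
determines `b`, through frequencies among its columns (`exists_ae_eq_snd_preimage`), and also the
sampled measure, through frequencies among its rows (`freqs_ae_eq`). Hence `ν` is the conditional
law of the additional row given the array alone, and this is almost surely the sampled measure as
recovered from the rows. -/

theorem ext_of_cylinders {μ ν : Measure (ℕ → S)} [IsProbabilityMeasure μ] [IsProbabilityMeasure ν]
    (h : ∀ (s : Finset ℕ) (B : ℕ → Set S), (∀ i, MeasurableSet (B i)) →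
      μ ((s : Set ℕ).pi B) = ν ((s : Set ℕ).pi B)) : μ = ν := by
  refine ext_of_generate_finite _ (generateFrom_squareCylinders (α := fun _ : ℕ => S)).symm
    (isPiSystem_squareCylinders (fun _ => MeasurableSpace.isPiSystem_measurableSet)
      fun _ => MeasurableSet.univ) ?_ (by simp)
  rintro _ ⟨s, t, ht, rfl⟩
  exact h s t fun i => ht i (mem_univ i)

theorem measurable_infinitePi (κ : ℕ → Kernel X S) [∀ i, IsMarkovKernel (κ i)] :
    Measurable fun x => Measure.infinitePi fun i => κ i x := by
  refine Measurable.measure_of_isPiSystem_of_isProbabilityMeasure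
    (generateFrom_squareCylinders (α := fun _ : ℕ => S)).symm
    (isPiSystem_squareCylinders (fun _ => MeasurableSpace.isPiSystem_measurableSet)
      fun _ => MeasurableSet.univ) ?_
  rintro _ ⟨s, t, ht, rfl⟩
  have ht' : ∀ i ∈ s, MeasurableSet (t i) := fun i _ => ht i (mem_univ i)
  simp only [Measure.infinitePi_pi _ ht']
  exact Finset.measurable_prod _ fun i hi => (κ i).measurable_coe (ht' i hi)

/-- The product `x ↦ ⨂ i, κ i x` of a sequence of Markov kernels. -/
noncomputable def seqKernel (κ : ℕ → Kernel X S) [∀ i, IsMarkovKernel (κ i)] :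
    Kernel X (ℕ → S) :=
  ⟨fun x => Measure.infinitePi fun i => κ i x, measurable_infinitePi κ⟩

theorem seqKernel_apply (κ : ℕ → Kernel X S) [∀ i, IsMarkovKernel (κ i)] (x : X) :
    seqKernel κ x = Measure.infinitePi fun i => κ i x := rfl

instance (κ : ℕ → Kernel X S) [∀ i, IsMarkovKernel (κ i)] : IsMarkovKernel (seqKernel κ) :=
  ⟨fun x => by rw [seqKernel_apply]; infer_instance⟩

/-- The kernel of i.i.d. sequences, `x ↦ (κ x)^{⊗ℕ}`. -/
noncomputable abbrev powKernel (κ : Kernel X S) [IsMarkovKernel κ] : Kernel X (ℕ → S) :=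
  seqKernel fun _ => κ

/-- The tautological kernel from `Pr S` to `S`. -/
noncomputable def evalKernel (S : Type*) [MeasurableSpace S] : Kernel (ProbabilityMeasure S) S :=
  ⟨fun m => (m : Measure S), measurable_subtype_coe⟩

theorem evalKernel_apply (m : ProbabilityMeasure S) : evalKernel S m = (m : Measure S) := rfl

instance : IsMarkovKernel (evalKernel S) := ⟨fun m => by rw [evalKernel_apply]; infer_instance⟩

end Sequences

/-! ### De Finetti's theorem -/

section DeFinetti

variable {S : Type*} [MeasurableSpace S]

/-- Values are corrected one at a time: a transposition applied after `σ` repairs the value at `n`,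
and injectivity of `σ` and `p` keeps it away from the earlier values. -/
theorem exists_isFinitary_eq {p : ℕ → ℕ} (hp : p.Injective) (n : ℕ) :
    ∃ σ : Equiv.Perm ℕ, IsFinitary σ ∧ ∀ i < n, σ i = p i := by
  induction n with
  | zero => exact ⟨1, by simp [IsFinitary], by simp⟩
  | succ n ih =>
    obtain ⟨σ, hσ, h⟩ := ih
    refine ⟨Equiv.swap (σ n) (p n) * σ, ?_, fun i hi => ?_⟩
    · refine (hσ.union (Set.toFinite {n, σ.symm (p n)})).subset fun i hi => ?_
      by_contra hc
      simp only [mem_union, mem_ofPred_eq, mem_insert_iff, mem_singleton_iff, not_or, not_not] at hc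
      apply hi
      rw [Equiv.Perm.mul_apply, Equiv.swap_apply_of_ne_of_ne, hc.1]
      · exact fun h => hc.2.1 (σ.injective h)
      · exact fun h => hc.2.2 (by rw [← h]; simp)
    · rcases Nat.lt_succ_iff_lt_or_eq.1 hi with hi | rfl
      · rw [Equiv.Perm.mul_apply, Equiv.swap_apply_of_ne_of_ne, h i hi]
        · exact fun h => hi.ne (σ.injective h)
        · rw [h i hi]; exact fun h => hi.ne (hp h)
      · simp

theorem measurable_reindex (p : ℕ → ℕ) : Measurable fun (y : ℕ → S) i => y (p i) := by fun_prop

/-- A cylinder sees finitely many coordinates, where an injection agrees with a finitary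
permutation. Passing to injections allows terms to be discarded, as in restricting to even or odd
indices. -/
theorem map_reindex_of_injective {Λ : Measure (ℕ → S)} [IsProbabilityMeasure Λ]
    (hΛ : ∀ σ : Equiv.Perm ℕ, IsFinitary σ → Λ.map (permute σ) = Λ)
    {p : ℕ → ℕ} (hp : p.Injective) : Λ.map (fun y i => y (p i)) = Λ := by
  have := Measure.isProbabilityMeasure_map (μ := Λ) (measurable_reindex (S := S) p).aemeasurable
  refine ext_of_cylinders fun s B hB => ?_
  obtain ⟨σ, hσ, h⟩ := exists_isFinitary_eq hp (s.sup id + 1)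
  have hm : MeasurableSet ((s : Set ℕ).pi B) := .pi s.countable_toSet fun i _ => hB i
  conv_rhs => rw [← hΛ σ hσ]
  rw [Measure.map_apply (measurable_reindex p) hm, Measure.map_apply (measurable_permute σ) hm]
  congr 1
  ext y
  simp only [mem_preimage, Set.mem_pi, permute]
  refine forall₂_congr fun i hi => ?_
  rw [h i (Nat.lt_succ_of_le (Finset.le_sup (f := id) hi))]

theorem lintegral_reindex {Λ : Measure (ℕ → S)}
    (hΛ : ∀ p : ℕ → ℕ, p.Injective → Λ.map (fun y i => y (p i)) = Λ)
    {p : ℕ → ℕ} (hp : p.Injective) {f : (ℕ → S) → ℝ≥0∞}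
    (hf : Measurable f) : ∫⁻ y, f (fun i => y (p i)) ∂Λ = ∫⁻ y, f y ∂Λ := by
  conv_rhs => rw [← hΛ p hp]
  rw [lintegral_map hf (measurable_reindex p)]

variable [StandardBorelSpace S] [Nonempty S]

/-- The conditional law of the first term of a random sequence given the other ones. -/
noncomputable def headKernel (Λ : Measure (ℕ → S)) [IsProbabilityMeasure Λ] :
    Kernel (ℕ → S) S :=
  (Λ.map fun y => ((fun i => y (i + 1)), y 0)).condKernel

instance (Λ : Measure (ℕ → S)) [IsProbabilityMeasure Λ] : IsMarkovKernel (headKernel Λ) := by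
  unfold headKernel; infer_instance

variable {Λ : Measure (ℕ → S)} [IsProbabilityMeasure Λ]
  (hΛ : ∀ p : ℕ → ℕ, p.Injective → Λ.map (fun y i => y (p i)) = Λ)

include hΛ

theorem lintegral_head_mul_tail {B : Set S} (hB : MeasurableSet B) {G : (ℕ → S) → ℝ≥0∞}
    (hG : Measurable G) :
    ∫⁻ y, B.indicator 1 (y 0) * G (fun i => y (i + 1)) ∂Λ = ∫⁻ w, headKernel Λ w B * G w ∂Λ := by
  set ρ := Λ.map fun y => ((fun i => y (i + 1)), y 0) with hρ
  have hm : Measurable fun y : ℕ → S => ((fun i => y (i + 1)), y 0) := by fun_prop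
  -- The tail has law `Λ` again, so the disintegration is over `Λ` itself.
  have h1 : ρ.fst = Λ := by
    rw [Measure.fst, hρ, Measure.map_map measurable_fst hm]
    exact hΛ _ (add_left_injective 1)
  have h2 : Λ ⊗ₘ headKernel Λ = ρ := by
    have h3 := ρ.disintegrate ρ.condKernel
    rwa [h1] at h3
  have hF : Measurable fun q : (ℕ → S) × S => B.indicator (1 : S → ℝ≥0∞) q.2 * G q.1 :=
    ((measurable_one.indicator hB).comp measurable_snd).mul (hG.comp measurable_fst)
  calc _ = ∫⁻ q, B.indicator (1 : S → ℝ≥0∞) q.2 * G q.1 ∂ρ := by rw [hρ, lintegral_map hF hm]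
    _ = ∫⁻ w, ∫⁻ x, B.indicator (1 : S → ℝ≥0∞) x * G w ∂(headKernel Λ w) ∂Λ := by
      rw [← h2, Measure.lintegral_compProd hF]
    _ = _ := by
      refine lintegral_congr fun w => ?_
      rw [lintegral_mul_const _ (measurable_one.indicator hB), lintegral_indicator_one hB]

/-- Conditioning the first term on all other terms, or only on those of odd index, gives the same
conditional law. -/
theorem headKernel_odd_ae_eq_tail {B : Set S} (hB : MeasurableSet B) :
    (fun y : ℕ → S => headKernel Λ (fun i => y (2 * i + 1)) B) =ᵐ[Λ]
      fun y => headKernel Λ (fun i => y (i + 1)) B := by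
  have hh : Measurable fun w => headKernel Λ w B := (headKernel Λ).measurable_coe hB
  set h : (ℕ → S) → ℝ≥0∞ := fun w => headKernel Λ w B with hdef
  have hle : ∀ w, h w ≤ 1 := fun w => prob_le_one
  -- An L² argument: with `a` and `c` the two conditional probabilities, `E a²`, `E c²` and `E ca`
  -- all equal `K`, so `E (a - c)² = 0`.
  set K := ∫⁻ w, h w * h w ∂Λ with hK
  have hodd : Function.Injective fun i : ℕ => 2 * i + 1 := fun i j hij => by simpa using hij
  have hKa : ∫⁻ y, h (fun i => y (2 * i + 1)) * h (fun i => y (2 * i + 1)) ∂Λ = K :=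
    lintegral_reindex hΛ hodd (f := fun w => h w * h w) (hh.mul hh)
  have hKc : ∫⁻ y, h (fun i => y (i + 1)) * h (fun i => y (i + 1)) ∂Λ = K :=
    lintegral_reindex hΛ (add_left_injective 1) (f := fun w => h w * h w) (hh.mul hh)
  have hKac : ∫⁻ y, h (fun i => y (i + 1)) * h (fun i => y (2 * i + 1)) ∂Λ = K := by
    have h1 := lintegral_head_mul_tail hΛ hB (G := fun w => h fun i => w (2 * i)) (by fun_prop)
    have h2 := lintegral_reindex hΛ (add_left_injective 1)
      (f := fun w => h w * h fun i => w (2 * i)) (by fun_prop)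
    have h3 := lintegral_head_mul_tail hΛ hB hh
    -- This reindexing keeps term 0 and carries the tail to the odd-indexed terms, so the head
    -- correlates equally with `h` of either one.
    have hinj : Function.Injective fun i : ℕ => if i = 0 then 0 else 2 * i - 1 := by
      intro i j hij; dsimp only at hij; split_ifs at hij <;> omega
    have hm : Measurable fun y : ℕ → S => B.indicator (1 : S → ℝ≥0∞) (y 0) *
        h (fun i => y (i + 1)) :=
      ((measurable_one.indicator hB).comp (measurable_pi_apply 0)).mul (by fun_prop)
    have h4 := lintegral_reindex hΛ hinj hm
    rw [h2, ← h1, hK, ← h3, ← h4]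
    rfl
  have hreal : ∀ {f : (ℕ → S) → ℝ≥0∞}, Measurable f → (∀ y, f y ≤ 1) →
      Integrable (fun y => (f y).toReal) Λ := fun hf hf1 =>
    Integrable.of_bound hf.ennreal_toReal.aestronglyMeasurable 1 <| .of_forall fun y => by
      rw [Real.norm_of_nonneg ENNReal.toReal_nonneg]
      exact ENNReal.toReal_le_of_le_ofReal zero_le_one (by simpa using hf1 y)
  have hint : ∀ {f : (ℕ → S) → ℝ≥0∞}, Measurable f → (∀ y, f y ≤ 1) →
      ∫ y, (f y).toReal ∂Λ = (∫⁻ y, f y ∂Λ).toReal := fun hf hf1 =>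
    integral_toReal hf.aemeasurable (.of_forall fun y => (hf1 y).trans_lt ENNReal.one_lt_top)
  set a : (ℕ → S) → ℝ≥0∞ := fun y => h fun i => y (2 * i + 1) with ha
  set c : (ℕ → S) → ℝ≥0∞ := fun y => h fun i => y (i + 1) with hc
  have hma : Measurable a := by fun_prop
  have hmc : Measurable c := by fun_prop
  have hmul : ∀ u v : ℝ≥0∞, u ≤ 1 → v ≤ 1 → u * v ≤ 1 := fun u v hu hv => mul_le_one' hu hv
  have haa := fun y => hmul (a y) (a y) (hle _) (hle _)
  have hcc := fun y => hmul (c y) (c y) (hle _) (hle _)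
  have hca := fun y => hmul (c y) (a y) (hle _) (hle _)
  have hzero : ∫ y, ((a y).toReal - (c y).toReal) ^ 2 ∂Λ = 0 := by
    have he : ∀ y, ((a y).toReal - (c y).toReal) ^ 2 =
        (a y * a y).toReal + (c y * c y).toReal - 2 * (c y * a y).toReal := fun y => by
      simp only [ENNReal.toReal_mul]; ring
    simp only [he]
    have iaa : Integrable (fun y => (a y * a y).toReal) Λ := hreal (hma.mul hma) haa
    have icc : Integrable (fun y => (c y * c y).toReal) Λ := hreal (hmc.mul hmc) hcc
    have ica : Integrable (fun y => (c y * a y).toReal) Λ := hreal (hmc.mul hma) hca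
    have iac : Integrable (fun y => (a y * a y).toReal + (c y * c y).toReal) Λ := iaa.add icc
    rw [integral_sub iac (ica.const_mul 2), integral_add iaa icc,
      integral_const_mul, hint (f := fun y => a y * a y) (hma.mul hma) haa,
      hint (f := fun y => c y * c y) (hmc.mul hmc) hcc,
      hint (f := fun y => c y * a y) (hmc.mul hma) hca, hKa, hKc, hKac]
    ring
  rw [integral_eq_zero_iff_of_nonneg (fun y => sq_nonneg _)] at hzero
  · filter_upwards [hzero] with y hy
    have : (a y).toReal = (c y).toReal := by
      have := pow_eq_zero_iff (n := 2) (by norm_num) |>.1 hy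
      linarith
    exact (ENNReal.toReal_eq_toReal_iff' ((hle _).trans_lt ENNReal.one_lt_top).ne
      ((hle _).trans_lt ENNReal.one_lt_top).ne).1 this
  · refine Integrable.of_bound
      ((hma.ennreal_toReal.sub hmc.ennreal_toReal).pow_const 2).aestronglyMeasurable 1
      (.of_forall fun y => ?_)
    have h1 : (a y).toReal ≤ 1 := ENNReal.toReal_le_of_le_ofReal zero_le_one (by simpa using hle _)
    have h2 : (c y).toReal ≤ 1 := ENNReal.toReal_le_of_le_ofReal zero_le_one (by simpa using hle _)
    have h3 : 0 ≤ (a y).toReal := ENNReal.toReal_nonneg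
    have h4 : 0 ≤ (c y).toReal := ENNReal.toReal_nonneg
    rw [Real.norm_of_nonneg (sq_nonneg _)]
    nlinarith

/-- Given the odd-indexed terms, the even-indexed ones are i.i.d. with law `headKernel`. The general
factor `G` serves the induction: it absorbs each conditional probability once that has become a
function of the odd terms. -/
theorem lintegral_prod_even_mul_odd (s : Finset ℕ) {B : ℕ → Set S}
    (hB : ∀ i, MeasurableSet (B i)) {G : (ℕ → S) → ℝ≥0∞} (hG : Measurable G) :
    ∫⁻ y, (∏ i ∈ s, (B i).indicator 1 (y (2 * i))) * G (fun i => y (2 * i + 1)) ∂Λ =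
      ∫⁻ y, (∏ i ∈ s, headKernel Λ y (B i)) * G y ∂Λ := by
  have hind : ∀ i j, Measurable fun y : ℕ → S => (B i).indicator (1 : S → ℝ≥0∞) (y j) :=
    fun i j => (measurable_one.indicator (hB i)).comp (measurable_pi_apply j)
  have hker : ∀ i, Measurable fun y => headKernel Λ y (B i) :=
    fun i => (headKernel Λ).measurable_coe (hB i)
  have hprod : ∀ (s : Finset ℕ) (q : ℕ → ℕ), Measurable fun y : ℕ → S =>
      ∏ i ∈ s, (B i).indicator (1 : S → ℝ≥0∞) (y (q i)) := fun s q =>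
    Finset.measurable_prod _ fun i _ => hind i (q i)
  induction s using Finset.induction_on generalizing G with
  | empty =>
    simp only [Finset.prod_empty, one_mul]
    exact lintegral_reindex hΛ (fun i j hij => by simpa using hij) hG
  | insert j s hj ih =>
    -- Moves term `2 * j` to the head and the other even terms up by two to make room; odd terms
    -- stay. `hq` later undoes the shift of the even terms.
    have hp : Function.Injective fun k : ℕ =>
        if k = 2 * j then 0 else if k % 2 = 0 then k + 2 else k := by
      intro k l hkl; dsimp only at hkl; split_ifs at hkl <;> omega
    have hq : Function.Injective fun k : ℕ => if k % 2 = 0 then k + 2 else k := by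
      intro k l hkl; dsimp only at hkl; split_ifs at hkl <;> omega
    have hpo : ∀ i, 2 * i + 1 ≠ 2 * j := by omega
    have hmod : ∀ i, (2 * i + 1) % 2 ≠ 0 := by omega
    calc ∫⁻ y, (∏ i ∈ insert j s, (B i).indicator 1 (y (2 * i))) * G (fun i => y (2 * i + 1)) ∂Λ
        = ∫⁻ y, (B j).indicator 1 (y 0) *
            ((∏ i ∈ s, (B i).indicator 1 (y (2 * i + 1 + 1))) * G fun i => y (2 * i + 1)) ∂Λ := by
          rw [← lintegral_reindex hΛ hp (f := fun y =>
            (∏ i ∈ insert j s, (B i).indicator 1 (y (2 * i))) * G fun i => y (2 * i + 1))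
            ((hprod _ _).mul (by fun_prop))]
          refine lintegral_congr fun y => ?_
          rw [Finset.prod_insert hj, mul_assoc]
          simp only [if_true, hpo, hmod, if_false]
          congr 2
          refine Finset.prod_congr rfl fun i hi => ?_
          have : 2 * i ≠ 2 * j := fun h => hj (by rwa [show j = i by omega])
          simp [this]
      _ = ∫⁻ w, headKernel Λ w (B j) *
            ((∏ i ∈ s, (B i).indicator 1 (w (2 * i + 1))) * G fun i => w (2 * i)) ∂Λ :=
          lintegral_head_mul_tail hΛ (hB j)
            (G := fun w => (∏ i ∈ s, (B i).indicator 1 (w (2 * i + 1))) * G fun i => w (2 * i))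
            ((hprod _ _).mul (by fun_prop))
      _ = ∫⁻ y, headKernel Λ (fun i => y (i + 1)) (B j) *
            ((∏ i ∈ s, (B i).indicator 1 (y (2 * i + 1 + 1))) * G fun i => y (2 * i + 1)) ∂Λ :=
          (lintegral_reindex hΛ (add_left_injective 1)
            ((hker j).mul ((hprod _ _).mul (by fun_prop)))).symm
      _ = ∫⁻ y, headKernel Λ (fun i => y (2 * i + 1)) (B j) *
            ((∏ i ∈ s, (B i).indicator 1 (y (2 * i + 1 + 1))) * G fun i => y (2 * i + 1)) ∂Λ := by
          refine lintegral_congr_ae ?_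
          filter_upwards [headKernel_odd_ae_eq_tail hΛ (hB j)] with y hy
          rw [hy]
      _ = ∫⁻ y, (∏ i ∈ s, (B i).indicator 1 (y (2 * i))) *
            (headKernel Λ (fun i => y (2 * i + 1)) (B j) * G fun i => y (2 * i + 1)) ∂Λ := by
          rw [← lintegral_reindex hΛ hq (f := fun y => (∏ i ∈ s, (B i).indicator 1 (y (2 * i))) *
            (headKernel Λ (fun i => y (2 * i + 1)) (B j) * G fun i => y (2 * i + 1))) ((hprod s fun i => 2 * i).mul
            (((hker j).comp (measurable_reindex _)).mul (hG.comp (measurable_reindex _))))]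
          refine lintegral_congr fun y => ?_
          simp [mul_left_comm]
      _ = ∫⁻ y, (∏ i ∈ s, headKernel Λ y (B i)) * (headKernel Λ y (B j) * G y) ∂Λ :=
          ih ((hker j).mul hG)
      _ = _ := by
          refine lintegral_congr fun y => ?_
          rw [Finset.prod_insert hj]; ring

/-- **De Finetti's theorem**: an exchangeable law is a mixture of laws of i.i.d. sequences. -/
theorem lintegral_powKernel_headKernel {D : Set (ℕ → S)} (hD : MeasurableSet D) :
    ∫⁻ w, powKernel (headKernel Λ) w D ∂Λ = Λ D := by
  suffices h : powKernel (headKernel Λ) ∘ₘ Λ = Λ by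
    conv_rhs => rw [← h]
    rw [Measure.bind_apply hD (powKernel (headKernel Λ)).measurable.aemeasurable]
  refine ext_of_cylinders fun s B hB => ?_
  have hm : MeasurableSet ((s : Set ℕ).pi B) := .pi s.countable_toSet fun i _ => hB i
  rw [Measure.bind_apply hm (powKernel (headKernel Λ)).measurable.aemeasurable]
  have h := lintegral_prod_even_mul_odd hΛ s hB (G := fun _ => 1) measurable_const
  simp only [mul_one] at h
  have h1 : ∀ w, powKernel (headKernel Λ) w ((s : Set ℕ).pi B) =
      ∏ i ∈ s, headKernel Λ w (B i) := fun w =>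
    Measure.infinitePi_pi _ fun i _ => hB i
  simp only [h1]
  have h2 : ∀ y : ℕ → S, ∏ i ∈ s, (B i).indicator (1 : S → ℝ≥0∞) (y i) =
      ((s : Set ℕ).pi B).indicator 1 y := fun y => by
    classical
    by_cases hy : y ∈ (s : Set ℕ).pi B
    · rw [indicator_of_mem hy]
      exact Finset.prod_eq_one fun i hi => by rw [indicator_of_mem (hy i hi)]; rfl
    · rw [indicator_of_notMem hy]
      simp only [Set.mem_pi, not_forall] at hy
      obtain ⟨i, hi, hy⟩ := hy
      exact Finset.prod_eq_zero hi (indicator_of_notMem hy _)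
  -- By exchangeability the even-indexed subsequence has law `Λ`, so the cylinder may be tested on
  -- it.
  rw [← h, ← lintegral_indicator_one hm, ← lintegral_reindex hΛ
    (p := fun i => 2 * i) (fun i j hij => by simpa using hij) (measurable_one.indicator hm)]
  exact lintegral_congr fun y => h2 _

end DeFinetti

/-! ### Products of composition-products -/

section CompProd

variable {C A : Type*} [MeasurableSpace C] [MeasurableSpace A]

/-- The kernel `c ↦ ⨂ i, κ (c i)`. -/
noncomputable def coordKernel (κ : Kernel C A) [IsMarkovKernel κ] : Kernel (ℕ → C) (ℕ → A) :=
  seqKernel fun i => κ.comap (fun c => c i) (measurable_pi_apply i)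

instance (κ : Kernel C A) [IsMarkovKernel κ] : IsMarkovKernel (coordKernel κ) := by
  unfold coordKernel; infer_instance

theorem lintegral_infinitePi_prod (μ : Measure C) [IsProbabilityMeasure μ] (s : Finset ℕ)
    {g : ℕ → C → ℝ≥0∞} (hg : ∀ i, Measurable (g i)) :
    ∫⁻ c, ∏ i ∈ s, g i (c i) ∂(Measure.infinitePi fun _ : ℕ => μ) =
      ∏ i ∈ s, ∫⁻ x, g i x ∂μ := by
  refine (lintegral_prod_eq_prod_lintegral_of_indepFun s (fun i (c : ℕ → C) => g i (c i))
    (iIndepFun_infinitePi (P := fun _ : ℕ => μ) hg) fun i => (hg i).comp (measurable_pi_apply i)).trans ?_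
  refine Finset.prod_congr rfl fun i _ => ?_
  exact (measurePreserving_eval_infinitePi (fun _ : ℕ => μ) i).lintegral_comp (hg i)

/-- Independent pairs arise by drawing all first components and then, independently, each second
component given its own first one. On cylinders both sides factor over the coordinates. -/
theorem infinitePi_compProd (μ : Measure C) [IsProbabilityMeasure μ] (κ : Kernel C A)
    [IsMarkovKernel κ] :
    Measure.infinitePi (fun _ : ℕ => μ ⊗ₘ κ) =
      ((Measure.infinitePi fun _ : ℕ => μ) ⊗ₘ coordKernel κ).map
        fun (q : (ℕ → C) × (ℕ → A)) i => (q.1 i, q.2 i) := by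
  refine (Measure.eq_infinitePi _ fun s t ht => ?_).symm
  have hm : Measurable fun (q : (ℕ → C) × (ℕ → A)) i => (q.1 i, q.2 i) := by fun_prop
  have hs : MeasurableSet ((s : Set ℕ).pi t) := .pi s.countable_toSet fun i _ => ht i
  rw [Measure.map_apply hm hs, Measure.compProd_apply (hm hs)]
  have h : ∀ c : ℕ → C, coordKernel κ c (Prod.mk c ⁻¹'
      ((fun (q : (ℕ → C) × (ℕ → A)) i => (q.1 i, q.2 i)) ⁻¹' ((s : Set ℕ).pi t))) =
      ∏ i ∈ s, κ (c i) (Prod.mk (c i) ⁻¹' t i) := fun c =>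
    Measure.infinitePi_pi (t := fun i => Prod.mk (c i) ⁻¹' t i) _
      fun i _ => measurable_prodMk_left (ht i)
  simp only [h]
  rw [lintegral_infinitePi_prod μ s (g := fun i x => κ x (Prod.mk x ⁻¹' t i))
    fun i => Kernel.measurable_kernel_prodMk_left (ht i)]
  exact Finset.prod_congr rfl fun i _ => (Measure.compProd_apply (ht i)).symm

theorem infinitePi_compProd_apply (μ : Measure C) [IsProbabilityMeasure μ] (κ : Kernel C A)
    [IsMarkovKernel κ] {D : Set (ℕ → C)} (hD : MeasurableSet D) {B : Set (ℕ → A)}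
    (hB : MeasurableSet B) :
    Measure.infinitePi (fun _ : ℕ => μ ⊗ₘ κ)
        {s | (fun i => (s i).1) ∈ D ∧ (fun i => (s i).2) ∈ B} =
      ∫⁻ c in D, Measure.infinitePi (fun i => κ (c i)) B
        ∂(Measure.infinitePi fun _ : ℕ => μ) := by
  have hm : Measurable fun (q : (ℕ → C) × (ℕ → A)) i => (q.1 i, q.2 i) := by fun_prop
  have hs : MeasurableSet {s : ℕ → C × A | (fun i => (s i).1) ∈ D ∧ (fun i => (s i).2) ∈ B} :=
    ((by fun_prop : Measurable fun (s : ℕ → C × A) i => (s i).1) hD).inter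
      ((by fun_prop : Measurable fun (s : ℕ → C × A) i => (s i).2) hB)
  rw [infinitePi_compProd, Measure.map_apply hm hs]
  exact Measure.compProd_apply_prod hD hB

end CompProd

/-! ### Recovering a probability measure from an i.i.d. sample -/

section Frequency

variable {E : Type*} [MeasurableSpace E]

/-- The asymptotic frequency (as an upper limit) with which a sequence visits `B`. -/
noncomputable def freq (B : Set E) (x : ℕ → E) : ℝ≥0∞ :=
  limsup (fun n : ℕ => ENNReal.ofReal ((∑ i ∈ Finset.range n, B.indicator 1 (x i)) / n)) atTop

theorem measurable_freq {B : Set E} (hB : MeasurableSet B) : Measurable (freq B) := by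
  refine Measurable.limsup fun n => ?_
  refine (Measurable.div_const (Finset.measurable_fun_sum _ fun i _ => ?_) _).ennreal_ofReal
  exact (measurable_one.indicator hB).comp (measurable_pi_apply i)

/-- The strong law of large numbers for the indicators of `B` along the sample. -/
theorem freq_ae_eq (m : Measure E) [IsProbabilityMeasure m] {B : Set E} (hB : MeasurableSet B) :
    ∀ᵐ x ∂(Measure.infinitePi fun _ : ℕ => m), freq B x = m B := by
  have hm : Measurable (B.indicator (1 : E → ℝ)) := measurable_one.indicator hB
  have hev := fun i => measurePreserving_eval_infinitePi (fun _ : ℕ => m) i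
  have hint : Integrable (B.indicator (1 : E → ℝ)) m :=
    (integrable_const (1 : ℝ)).indicator hB
  have h := strong_law_ae_real (μ := Measure.infinitePi fun _ : ℕ => m)
    (fun i x => B.indicator (1 : E → ℝ) (x i))
    ((hev 0).integrable_comp_of_integrable hint)
    (fun i j hij => (iIndepFun_infinitePi (P := fun _ : ℕ => m)
      (X := fun _ => B.indicator (1 : E → ℝ)) fun _ => hm).indepFun hij)
    (fun i => ⟨(hm.comp (measurable_pi_apply i)).aemeasurable,
      (hm.comp (measurable_pi_apply 0)).aemeasurable, by
        have h1 := fun i => Measure.map_map (μ := Measure.infinitePi fun _ : ℕ => m) hm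
          (hev i).measurable
        simp only [(hev _).map_eq] at h1
        exact (h1 i).symm.trans (h1 0)⟩)
  filter_upwards [h] with x hx
  have h0 : ∫ x, B.indicator (1 : E → ℝ) (x 0) ∂(Measure.infinitePi fun _ : ℕ => m) = m.real B := by
    have h1 := integral_map (μ := Measure.infinitePi fun _ : ℕ => m) (hev 0).measurable.aemeasurable
      (f := B.indicator (1 : E → ℝ)) hm.aestronglyMeasurable
    rw [(hev 0).map_eq, integral_indicator_one hB] at h1
    exact h1.symm
  rw [h0] at hx
  have := ((ENNReal.continuous_ofReal.tendsto _).comp hx).limsup_eq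
  rw [ofReal_measureReal] at this
  exact this

variable [MeasurableSpace.CountablyGenerated E]

variable (E) in
/-- A countable π-system generating the σ-algebra. -/
def basicSet (F : Finset ℕ) : Set E := ⋂ n ∈ F, MeasurableSpace.natGeneratingSequence E n

theorem measurableSet_basicSet (F : Finset ℕ) : MeasurableSet (basicSet E F) :=
  Finset.measurableSet_biInter _ fun n _ =>
    MeasurableSpace.measurableSet_natGeneratingSequence n

theorem generateFrom_basicSet :
    MeasurableSpace.generateFrom (range (basicSet E)) = ‹MeasurableSpace E› := by
  refine le_antisymm (MeasurableSpace.generateFrom_le ?_) ?_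
  · rintro _ ⟨F, rfl⟩
    exact measurableSet_basicSet F
  · conv_lhs => rw [← MeasurableSpace.generateFrom_natGeneratingSequence E]
    refine MeasurableSpace.generateFrom_mono ?_
    rintro _ ⟨n, rfl⟩
    exact ⟨{n}, by simp [basicSet]⟩

theorem isPiSystem_basicSet : IsPiSystem (range (basicSet E)) := by
  rintro _ ⟨F, rfl⟩ _ ⟨G, rfl⟩ -
  exact ⟨F ∪ G, by ext; simp [basicSet, or_imp, forall_and]⟩

variable (E) in
/-- The values of a probability measure on the sets of a generating π-system. -/
noncomputable def coords (m : ProbabilityMeasure E) (F : Finset ℕ) : ℝ≥0∞ :=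
  (m : Measure E) (basicSet E F)

theorem measurable_coords : Measurable (coords E) :=
  measurable_pi_lambda _ fun F =>
    (Measure.measurable_coe (measurableSet_basicSet F)).comp measurable_subtype_coe

/-- Countably many evaluations generate the σ-algebra of `Pr E`, because the values on a generating
π-system determine measurability of a family of probability measures. Almost sure statements can
then be checked on all coordinates at once. -/
theorem exists_preimage_coords {Γ : Set (ProbabilityMeasure E)} (hΓ : MeasurableSet Γ) :
    ∃ Γ', MeasurableSet Γ' ∧ coords E ⁻¹' Γ' = Γ := by
  have h : @Measurable _ _ (MeasurableSpace.comap (coords E) inferInstance) _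
      (id : ProbabilityMeasure E → ProbabilityMeasure E) := by
    let _ : MeasurableSpace (ProbabilityMeasure E) := MeasurableSpace.comap (coords E) inferInstance
    refine Measurable.subtype_mk (Measurable.measure_of_isPiSystem_of_isProbabilityMeasure
      (μ := fun m : ProbabilityMeasure E => (m : Measure E))
      generateFrom_basicSet.symm isPiSystem_basicSet ?_)
    rintro _ ⟨F, rfl⟩
    exact (measurable_pi_apply F).comp (comap_measurable (coords E))
  exact h hΓ

theorem ext_of_map_coords {P Q : Measure (ProbabilityMeasure E)}
    (h : P.map (coords E) = Q.map (coords E)) : P = Q := by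
  ext Γ hΓ
  obtain ⟨Γ', hΓ', rfl⟩ := exists_preimage_coords hΓ
  rw [← Measure.map_apply measurable_coords hΓ', h, Measure.map_apply measurable_coords hΓ']

/-- The asymptotic frequencies with which a sequence visits the sets of a generating π-system. -/
noncomputable def freqs (x : ℕ → E) (F : Finset ℕ) : ℝ≥0∞ := freq (basicSet E F) x

theorem measurable_freqs : Measurable (freqs (E := E)) :=
  measurable_pi_lambda _ fun F => measurable_freq (measurableSet_basicSet F)

theorem freqs_ae_eq (m : ProbabilityMeasure E) :
    ∀ᵐ x ∂(Measure.infinitePi fun _ : ℕ => (m : Measure E)), freqs x = coords E m := by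
  have h : ∀ᵐ x ∂(Measure.infinitePi fun _ : ℕ => (m : Measure E)), ∀ F,
      freq (basicSet E F) x = (m : Measure E) (basicSet E F) :=
    ae_all_iff.2 fun F => freq_ae_eq _ (measurableSet_basicSet F)
  filter_upwards [h] with x hx
  exact funext hx

end Frequency

/-! ### Randomization over the unit interval -/

section Randomization

/-- The inclusion of `[0,1)` in `[0,1]`. -/
def toUnitInterval (t : I01) : unitInterval := ⟨t.1, t.2.1, t.2.2.le⟩

theorem measurable_toUnitInterval : Measurable toUnitInterval :=
  measurable_subtype_coe.subtype_mk

theorem volume_unitInterval_eq_map_leb :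
    (volume : Measure unitInterval) = leb.map toUnitInterval := by
  have hI := MeasurableEmbedding.subtype_coe (measurableSet_Icc (a := (0 : ℝ)) (b := 1))
  have hJ := MeasurableEmbedding.subtype_coe (measurableSet_Ico (a := (0 : ℝ)) (b := 1))
  have h1 : (volume : Measure unitInterval).map Subtype.val =
      (leb.map toUnitInterval).map Subtype.val := by
    rw [unitInterval.measurePreserving_coe.map_eq, Measure.map_map hI.measurable measurable_toUnitInterval]
    change _ = leb.map Subtype.val
    rw [leb, hJ.map_comap, Subtype.range_coe]
    exact Measure.restrict_congr_set Ico_ae_eq_Icc.symm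
  ext s hs
  rw [← hI.injective.preimage_image s, ← hI.map_apply, ← hI.map_apply, h1]

variable {X W : Type*} [MeasurableSpace X] [MeasurableSpace W] [StandardBorelSpace W] [Nonempty W]

theorem exists_map_leb_eq (κ : Kernel X W) [IsMarkovKernel κ] :
    ∃ φ : X → I01 → W, Measurable (Function.uncurry φ) ∧ ∀ x, leb.map (φ x) = κ x := by
  obtain ⟨f, hf, h⟩ := κ.exists_measurable_map_eq_unitInterval
  refine ⟨fun x t => f x (toUnitInterval t),
    hf.comp (measurable_fst.prodMk (measurable_toUnitInterval.comp measurable_snd)), fun x => ?_⟩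
  rw [← h x, volume_unitInterval_eq_map_leb]
  exact (Measure.map_map (hf.comp measurable_prodMk_left) measurable_toUnitInterval).symm

/-- A random variable `w` can be resampled from a function `b w` of it and a uniform variable. -/
theorem exists_randomization (Λ : Measure W) [IsProbabilityMeasure Λ] {b : W → X}
    (hb : Measurable b) :
    ∃ φ : X → I01 → W, Measurable (Function.uncurry φ) ∧
      ∀ F : X × W → ℝ≥0∞, Measurable F →
        ∫⁻ x, ∫⁻ t, F (x, φ x t) ∂leb ∂(Λ.map b) = ∫⁻ w, F (b w, w) ∂Λ := by
  set ρ := Λ.map fun w => (b w, w) with hρ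
  have hm : Measurable fun w => (b w, w) := hb.prodMk measurable_id
  have : IsProbabilityMeasure ρ := Measure.isProbabilityMeasure_map hm.aemeasurable
  -- `φ x` pushes Lebesgue measure to the conditional law of `w` given `b w = x`.
  obtain ⟨φ, hφ, h⟩ := exists_map_leb_eq ρ.condKernel
  refine ⟨φ, hφ, fun F hF => ?_⟩
  have h1 : ρ.fst = Λ.map b := by
    rw [Measure.fst, hρ, Measure.map_map measurable_fst hm]; rfl
  calc _ = ∫⁻ x, ∫⁻ w, F (x, w) ∂(ρ.condKernel x) ∂ρ.fst := by
        rw [h1]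
        refine lintegral_congr fun x => ?_
        rw [← h x]
        exact (lintegral_map (hF.comp measurable_prodMk_left)
          (hφ.comp measurable_prodMk_left)).symm
    _ = ∫⁻ q, F q ∂ρ := by
        rw [← Measure.lintegral_compProd hF, ρ.disintegrate ρ.condKernel]
    _ = _ := by rw [hρ, lintegral_map hF hm]

end Randomization

/-! ### The law of the columns of a sampled array -/

section Columns

variable {A : Type*} [MeasurableSpace A]

/-- The transpose of an array. -/
def transpose (x : ℕ → ℕ → A) : ℕ → ℕ → A := fun i k => x k i

theorem measurable_transpose : Measurable (transpose (A := A)) := by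
  unfold transpose; fun_prop

/-- The columns of the array with rows `q.2`, together with the terms of the additional row
`q.1`. -/
def columns (q : (ℕ → A) × (ℕ → ℕ → A)) : ℕ → (ℕ → A) × A := fun i => (fun k => q.2 k i, q.1 i)

theorem measurable_columns : Measurable (columns (A := A)) := by
  unfold columns; fun_prop

variable (Q : Measure (ProbabilityMeasure (ℕ → A)))

/-- The law of an array whose rows are sampled independently from a random measure with
law `Q`. -/
noncomputable def rowLaw : Measure (ℕ → ℕ → A) := powKernel (evalKernel (ℕ → A)) ∘ₘ Q

/-- The law of the columns of an array and an additional row, when all rows are sampled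
independently from a random measure with law `Q`. -/
noncomputable def columnLaw : Measure (ℕ → (ℕ → A) × A) :=
  ((evalKernel (ℕ → A) ×ₖ powKernel (evalKernel (ℕ → A))) ∘ₘ Q).map columns

instance [IsProbabilityMeasure Q] : IsProbabilityMeasure (columnLaw Q) :=
  Measure.isProbabilityMeasure_map measurable_columns.aemeasurable

theorem lintegral_rowLaw {f : (ℕ → ℕ → A) → ℝ≥0∞} (hf : Measurable f) :
    ∫⁻ r, f r ∂(rowLaw Q) = ∫⁻ m, ∫⁻ r, f r ∂(Measure.infinitePi fun _ : ℕ => (m : Measure (ℕ → A)))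
      ∂Q :=
  Measure.lintegral_bind (powKernel (evalKernel (ℕ → A))).measurable.aemeasurable hf.aemeasurable

theorem columnLaw_apply {T : Set (ℕ → (ℕ → A) × A)} (hT : MeasurableSet T) :
    columnLaw Q T = ∫⁻ m, ((m : Measure (ℕ → A)).prod
      (Measure.infinitePi fun _ : ℕ => (m : Measure (ℕ → A)))) (columns ⁻¹' T) ∂Q := by
  rw [columnLaw, Measure.map_apply measurable_columns hT,
    Measure.bind_apply (measurable_columns hT) (Kernel.measurable _).aemeasurable]
  simp only [Kernel.prod_apply]
  rfl

/-- Given `m`, the additional row is independent of the array and lies in `B` with probability `m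
B`, which is almost surely `freq B r`. Thus its conditional law given the array is expressed through
the array alone. -/
theorem columnLaw_apply_rect {D : Set (ℕ → ℕ → A)} (hD : MeasurableSet D) {B : Set (ℕ → A)}
    (hB : MeasurableSet B) :
    columnLaw Q {s | (fun i => (s i).1) ∈ D ∧ (fun i => (s i).2) ∈ B} =
      ∫⁻ r in transpose ⁻¹' D, freq B r ∂(rowLaw Q) := by
  have hs : MeasurableSet {s : ℕ → (ℕ → A) × A |
      (fun i => (s i).1) ∈ D ∧ (fun i => (s i).2) ∈ B} :=
    ((by fun_prop : Measurable fun (s : ℕ → (ℕ → A) × A) i => (s i).1) hD).inter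
      ((by fun_prop : Measurable fun (s : ℕ → (ℕ → A) × A) i => (s i).2) hB)
  have hD' : MeasurableSet (transpose ⁻¹' D) := measurable_transpose hD
  rw [columnLaw_apply Q hs, ← lintegral_indicator hD',
    lintegral_rowLaw Q ((measurable_freq hB).indicator hD')]
  refine lintegral_congr fun m => ?_
  have h : columns ⁻¹' {s : ℕ → (ℕ → A) × A | (fun i => (s i).1) ∈ D ∧ (fun i => (s i).2) ∈ B} =
      B ×ˢ (transpose ⁻¹' D) := by
    ext q
    exact and_comm
  rw [h, Measure.prod_prod, lintegral_indicator hD', setLIntegral_congr_fun_ae hD'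
    (g := fun _ => (m : Measure (ℕ → A)) B), setLIntegral_const]
  filter_upwards [freq_ae_eq (m : Measure (ℕ → A)) hB] with r hr _ using hr

theorem measurable_map_permute (σ : Equiv.Perm ℕ) :
    Measurable fun m : ProbabilityMeasure (ℕ → A) => m.map (measurable_permute σ).aemeasurable :=
  Measurable.subtype_mk
    ((Measure.measurable_map _ (measurable_permute σ)).comp measurable_subtype_coe)

/-- Permuting the columns applies `permute σ` to every row, which amounts to sampling from the image
measure instead of `m`; `Q` does not see the difference. -/
theorem columnLaw_map_permute {σ : Equiv.Perm ℕ}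
    (hQ : Q.map (fun m => m.map (measurable_permute σ).aemeasurable) = Q) :
    (columnLaw Q).map (permute σ) = columnLaw Q := by
  ext T hT
  have hT' := measurable_permute σ hT
  rw [Measure.map_apply (measurable_permute σ) hT, columnLaw_apply Q hT', columnLaw_apply Q hT]
  conv_rhs => rw [← hQ]
  have hmeas : Measurable fun m : ProbabilityMeasure (ℕ → A) => ((m : Measure (ℕ → A)).prod
      (Measure.infinitePi fun _ : ℕ => (m : Measure (ℕ → A)))) (columns ⁻¹' T) := by
    have := (evalKernel (ℕ → A) ×ₖ powKernel (evalKernel (ℕ → A))).measurable_coe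
      (measurable_columns hT)
    simp only [Kernel.prod_apply] at this
    exact this
  rw [lintegral_map hmeas (measurable_map_permute σ)]
  refine lintegral_congr fun m => ?_
  have hpm : IsProbabilityMeasure ((m : Measure (ℕ → A)).map (permute σ)) :=
    Measure.isProbabilityMeasure_map (measurable_permute σ).aemeasurable
  have h1 : ((m.map (measurable_permute σ).aemeasurable : ProbabilityMeasure (ℕ → A)) :
      Measure (ℕ → A)) = (m : Measure (ℕ → A)).map (permute σ) := rfl
  simp only [h1]
  have h2 : Measurable fun (r : ℕ → ℕ → A) k => permute σ (r k) :=
    measurable_pi_lambda _ fun k => (measurable_permute σ).comp (measurable_pi_apply k)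
  rw [← Measure.infinitePi_map_pi (fun _ : ℕ => (m : Measure (ℕ → A)))
      (fun _ => measurable_permute σ), Measure.map_prod_map _ _ (measurable_permute σ) h2,
    Measure.map_apply ((measurable_permute σ).prodMap h2) (measurable_columns hT)]
  rfl

end Columns

/-! ### The mixture representation -/

section Mixture

variable {A : Type*} [MeasurableSpace A]

theorem measurable_mixProdFun {Ω : Type*} [MeasurableSpace Ω]
    {f : ℕ → Ω → I01 → ProbabilityMeasure A}
    (hf : ∀ i, Measurable fun p : Ω × I01 => f i p.1 p.2) :
    Measurable fun ω => mixProdFun (fun i => f i ω) fun i => (hf i).comp measurable_prodMk_left := by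
  refine Measurable.subtype_mk (Measure.measurable_of_measurable_coe _ fun B hB => ?_)
  have h : ∀ ω, (mixProdFun (fun i => f i ω) (fun i => (hf i).comp measurable_prodMk_left) :
      Measure (ℕ → A)) B = ∫⁻ t, (prodMeasure (fun i => f i ω t) : Measure (ℕ → A)) B ∂leb :=
    fun ω => mix_apply _ _ hB
  have hm : Measurable fun p : Ω × I01 =>
      (prodMeasure (fun i => f i p.1 p.2) : Measure (ℕ → A)) B :=
    (Measure.measurable_coe hB).comp
      (measurable_subtype_coe.comp (measurable_prodMeasure.comp (measurable_pi_lambda _ hf)))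
  have := hm.lintegral_prod_right' (ν := leb)
  simp only [← h] at this
  exact this

/-- The law of a random measure `b` with law `β`, together with a sample of it. -/
noncomputable def sampleLaw {C : Type*} [MeasurableSpace C] (β : Measure (ProbabilityMeasure C)) :
    Measure (ProbabilityMeasure C × (ℕ → C)) :=
  β ⊗ₘ powKernel (evalKernel C)

section SampleLaw

variable {C : Type*} [MeasurableSpace C] (β : Measure (ProbabilityMeasure C))

instance [IsProbabilityMeasure β] : IsProbabilityMeasure (sampleLaw β) := by
  unfold sampleLaw; infer_instance

/-- The action of a permutation on the sample. -/
def permuteSample (σ : Equiv.Perm ℕ) (ω : ProbabilityMeasure C × (ℕ → C)) :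
    ProbabilityMeasure C × (ℕ → C) := (ω.1, permute σ ω.2)

theorem measurable_permuteSample (σ : Equiv.Perm ℕ) :
    Measurable (permuteSample (C := C) σ) :=
  measurable_fst.prodMk ((measurable_permute σ).comp measurable_snd)

theorem sampleLaw_map_permuteSample [SFinite β] (σ : Equiv.Perm ℕ) :
    (sampleLaw β).map (permuteSample σ) = sampleLaw β := by
  ext T hT
  have hT' := measurable_permuteSample σ hT
  rw [Measure.map_apply (measurable_permuteSample σ) hT, sampleLaw, Measure.compProd_apply hT',
    Measure.compProd_apply hT]
  refine lintegral_congr fun b => ?_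
  have h := Measure.map_infinitePi_infinitePi_of_inj (P := fun _ : ℕ => (b : Measure C)) σ.injective
  change Measure.infinitePi (fun _ : ℕ => (b : Measure C)) _ =
    Measure.infinitePi (fun _ : ℕ => (b : Measure C)) _
  conv_rhs => rw [← h]
  change _ = (Measure.infinitePi fun _ : ℕ => (b : Measure C)).map (permute σ) _
  rw [Measure.map_apply (measurable_permute σ) (measurable_prodMk_left hT)]
  rfl

/-- Every event of the σ-algebra generated by a random measure and a sample of it is almost surely
an event of the σ-algebra generated by the sample. -/
theorem exists_ae_eq_snd_preimage [MeasurableSpace.CountablyGenerated C]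
    {T : Set (ProbabilityMeasure C × (ℕ → C))} (hT : MeasurableSet T) :
    ∃ D : Set (ℕ → C), MeasurableSet D ∧ T =ᵐ[sampleLaw β] Prod.snd ⁻¹' D := by
  obtain ⟨T', hT', rfl⟩ : ∃ T' : Set ((Finset ℕ → ℝ≥0∞) × (ℕ → C)), MeasurableSet T' ∧
      Prod.map (coords C) id ⁻¹' T' = T := by
    have h : @Measurable _ _ (MeasurableSpace.comap (Prod.map (coords C) (id : (ℕ → C) → ℕ → C))
        inferInstance) _ (id : ProbabilityMeasure C × (ℕ → C) → _) := by
      refine Measurable.prodMk (fun Γ hΓ => ?_) ?_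
      · obtain ⟨Γ', hΓ', rfl⟩ := exists_preimage_coords hΓ
        exact ⟨Prod.fst ⁻¹' Γ', measurable_fst hΓ', rfl⟩
      · exact fun D hD => ⟨Prod.snd ⁻¹' D, measurable_snd hD, rfl⟩
    exact h hT
  -- `D` comes from replacing the coordinates of the random measure by the frequencies of its
  -- sample, almost surely the same.
  have hD : Measurable fun c : ℕ → C => (freqs c, c) := measurable_freqs.prodMk measurable_id
  refine ⟨(fun c => (freqs c, c)) ⁻¹' T', hD hT', ?_⟩
  have h : ∀ᵐ ω ∂(sampleLaw β), freqs ω.2 = coords C ω.1 :=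
    Measure.ae_compProd_of_ae_ae (measurableSet_eq_fun (measurable_freqs.comp measurable_snd)
      (measurable_coords.comp measurable_fst)) (.of_forall fun b => freqs_ae_eq b)
  filter_upwards [h] with ω hω
  change (Prod.map (coords C) id ω ∈ T') = ((freqs ω.2, ω.2) ∈ T')
  rw [hω]
  rfl

end SampleLaw

variable [StandardBorelSpace A] [Nonempty A]

/-- A random probability measure whose law `Q` is invariant under finitary permutations is equal in
law to a mixture of product measures, the factors of which are functions of the mixing variable and
of the terms of a sequence that is i.i.d. given a random measure. -/
theorem exists_mixture (Q : Measure (ProbabilityMeasure (ℕ → A))) [IsProbabilityMeasure Q]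
    (hQ : ∀ σ : Equiv.Perm ℕ, IsFinitary σ →
      Q.map (fun m => m.map (measurable_permute σ).aemeasurable) = Q) :
    ∃ (β : Measure (ProbabilityMeasure (ℕ → A))) (_ : IsProbabilityMeasure β)
      (g : ProbabilityMeasure (ℕ → A) → I01 → (ℕ → A) → ProbabilityMeasure A)
      (hg : Measurable fun p : ProbabilityMeasure (ℕ → A) × I01 × (ℕ → A) => g p.1 p.2.1 p.2.2),
      (sampleLaw β).map (fun ω : ProbabilityMeasure (ℕ → A) × (ℕ → ℕ → A) =>
        mixProdFun (fun i t => g ω.1 t (ω.2 i)) fun i => hg.comp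
          (by fun_prop : Measurable fun t : I01 => (ω.1, t, ω.2 i))) = Q := by
  set Λ := columnLaw Q with hΛ
  have hinj : ∀ p : ℕ → ℕ, p.Injective → Λ.map (fun y i => y (p i)) = Λ := fun p hp =>
    map_reindex_of_injective (fun σ hσ => columnLaw_map_permute Q (hQ σ hσ)) hp
  set θ := headKernel Λ with hθ
  set κ := θ.condKernel with hκ
  have hθκ : ∀ w, θ w = θ.fst w ⊗ₘ κ.sectR w := fun w => by
    rw [← Kernel.compProd_apply_eq_compProd_sectR, θ.disintegrate κ]
  -- The directing measure of the array columns alone. `w` may carry more information, which the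
  -- mixing variable resupplies through `φ`.
  let b : (ℕ → (ℕ → A) × A) → ProbabilityMeasure (ℕ → A) := fun w => ⟨θ.fst w, inferInstance⟩
  have hb : Measurable b := θ.fst.measurable.subtype_mk
  obtain ⟨φ, hφ, hφF⟩ := exists_randomization Λ hb
  set β := Λ.map b with hβ
  have hβp : IsProbabilityMeasure β := Measure.isProbabilityMeasure_map hb.aemeasurable
  let g : ProbabilityMeasure (ℕ → A) → I01 → (ℕ → A) → ProbabilityMeasure A :=
    fun x t c => ⟨κ (φ x t, c), inferInstance⟩
  have hg : Measurable fun p : ProbabilityMeasure (ℕ → A) × I01 × (ℕ → A) =>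
      g p.1 p.2.1 p.2.2 := by
    refine Measurable.subtype_mk (κ.measurable.comp ?_)
    exact (hφ.comp (measurable_fst.prodMk measurable_snd.fst)).prodMk measurable_snd.snd
  let f : ℕ → (ProbabilityMeasure (ℕ → A) × (ℕ → ℕ → A)) → I01 → ProbabilityMeasure A :=
    fun i ω t => g ω.1 t (ω.2 i)
  have hf : ∀ i, Measurable fun p : (ProbabilityMeasure (ℕ → A) × (ℕ → ℕ → A)) × I01 =>
      f i p.1 p.2 := fun i => hg.comp (by fun_prop :
        Measurable fun p : (ProbabilityMeasure (ℕ → A) × (ℕ → ℕ → A)) × I01 =>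
          (p.1.1, p.2, p.1.2 i))
  let ν : ProbabilityMeasure (ℕ → A) × (ℕ → ℕ → A) → ProbabilityMeasure (ℕ → A) :=
    fun ω => mixProdFun (fun i => f i ω) fun i => (hf i).comp measurable_prodMk_left
  have hν : Measurable ν := measurable_mixProdFun hf
  refine ⟨β, hβp, g, hg, ?_⟩
  change (sampleLaw β).map ν = Q
  -- The product kernel, as a function of the directing variable and of the columns.
  let K : Kernel ((ℕ → (ℕ → A) × A) × (ℕ → ℕ → A)) (ℕ → A) :=
    seqKernel fun i => κ.comap (fun p => (p.1, p.2 i))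
      (by fun_prop : Measurable fun p : (ℕ → (ℕ → A) × A) × (ℕ → ℕ → A) => (p.1, p.2 i))
  have hνK : ∀ ω {B : Set (ℕ → A)}, MeasurableSet B →
      (ν ω : Measure (ℕ → A)) B = ∫⁻ t, K (φ ω.1 t, ω.2) B ∂leb := fun ω B hB => mix_apply _ _ hB
  -- Both sides are the probability that the array columns lie in `D` and the additional row in `B`:
  -- on the left by de Finetti and resampling of `w`, on the right by sampling the rows.
  have hA : ∀ {D : Set (ℕ → ℕ → A)} {B : Set (ℕ → A)}, MeasurableSet D → MeasurableSet B →
      ∫⁻ ω in Prod.snd ⁻¹' D, (ν ω : Measure (ℕ → A)) B ∂(sampleLaw β) =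
        ∫⁻ r in transpose ⁻¹' D, freq B r ∂(rowLaw Q) := by
    intro D B hD hB
    have hK : Measurable fun p => K p B := K.measurable_coe hB
    let η : Kernel (ProbabilityMeasure (ℕ → A) × (ℕ → (ℕ → A) × A)) (ℕ → ℕ → A) :=
      (powKernel (evalKernel (ℕ → A))).comap Prod.fst measurable_fst
    let F : ProbabilityMeasure (ℕ → A) × (ℕ → (ℕ → A) × A) → ℝ≥0∞ := fun p =>
      ∫⁻ c in D, K (p.2, c) B ∂(η p)
    have hF : Measurable F := by
      refine Measurable.setLIntegral_kernel_prod_right ?_ hD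
      exact hK.comp (by fun_prop : Measurable fun q :
        (ProbabilityMeasure (ℕ → A) × (ℕ → (ℕ → A) × A)) × (ℕ → ℕ → A) => (q.1.2, q.2))
    have hνm : Measurable fun ω => (ν ω : Measure (ℕ → A)) B :=
      (Measure.measurable_coe hB).comp (measurable_subtype_coe.comp hν)
    calc ∫⁻ ω in Prod.snd ⁻¹' D, (ν ω : Measure (ℕ → A)) B ∂(sampleLaw β)
        = ∫⁻ x, ∫⁻ c in D, (ν (x, c) : Measure (ℕ → A)) B
            ∂(powKernel (evalKernel (ℕ → A)) x) ∂β := by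
          rw [← univ_prod, sampleLaw, Measure.setLIntegral_compProd hνm .univ hD,
            Measure.restrict_univ]
      _ = ∫⁻ x, ∫⁻ t, F (x, φ x t) ∂leb ∂β := by
          refine lintegral_congr fun x => ?_
          simp only [hνK _ hB]
          refine lintegral_lintegral_swap (Measurable.aemeasurable ?_)
          exact hK.comp (((hφ.comp measurable_prodMk_left).comp measurable_snd).prodMk
            measurable_fst)
      _ = ∫⁻ w, F (b w, w) ∂Λ := hφF F hF
      _ = ∫⁻ w, powKernel θ w {s | (fun i => (s i).1) ∈ D ∧ (fun i => (s i).2) ∈ B} ∂Λ := by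
          refine lintegral_congr fun w => ?_
          rw [seqKernel_apply, hθκ w, infinitePi_compProd_apply _ _ hD hB]
          rfl
      _ = columnLaw Q {s | (fun i => (s i).1) ∈ D ∧ (fun i => (s i).2) ∈ B} :=
          lintegral_powKernel_headKernel hinj
            (((by fun_prop : Measurable fun (s : ℕ → (ℕ → A) × A) i => (s i).1) hD).inter
              ((by fun_prop : Measurable fun (s : ℕ → (ℕ → A) × A) i => (s i).2) hB))
      _ = _ := columnLaw_apply_rect Q hD hB
  -- The case `B = univ` of `hA`: the i.i.d. samples from `b` reproduce the array, transposed.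
  have hsnd : (sampleLaw β).map Prod.snd = (rowLaw Q).map transpose := by
    ext D hD
    have h1 := hA hD MeasurableSet.univ
    have h2 : ∀ᵐ r ∂(rowLaw Q), freq univ r = 1 := by
      refine Measure.ae_comp_of_ae_ae (measurable_freq MeasurableSet.univ (measurableSet_singleton 1))
        (.of_forall fun m => ?_)
      filter_upwards [freq_ae_eq (m : Measure (ℕ → A)) MeasurableSet.univ] with r hr
      rw [hr, measure_univ]
    rw [setLIntegral_congr_fun_ae (measurable_transpose hD) (g := fun _ => 1)
      (h2.mono fun r hr _ => hr)] at h1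
    simp only [measure_univ, setLIntegral_one] at h1
    rw [Measure.map_apply measurable_snd hD, Measure.map_apply measurable_transpose hD, h1]
  -- `hA` compares integrals only over events of the columns; since these determine `b` almost
  -- surely, that covers all events.
  have hcoords : ∀ᵐ ω ∂(sampleLaw β), coords (ℕ → A) (ν ω) = freqs (transpose ω.2) := by
    suffices h : ∀ F, (fun ω => (ν ω : Measure (ℕ → A)) (basicSet (ℕ → A) F)) =ᵐ[sampleLaw β]
        fun ω => freq (basicSet (ℕ → A) F) (transpose ω.2) by
      filter_upwards [ae_all_iff.2 h] with ω hω
      exact funext hω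
    intro F
    have hB := measurableSet_basicSet (E := ℕ → A) F
    have hfm : Measurable fun c : ℕ → ℕ → A => freq (basicSet (ℕ → A) F) (transpose c) :=
      (measurable_freq hB).comp measurable_transpose
    refine ae_eq_of_forall_setLIntegral_eq_of_sigmaFinite
      ((Measure.measurable_coe hB).comp (measurable_subtype_coe.comp hν))
      (hfm.comp measurable_snd) fun T hT _ => ?_
    obtain ⟨D, hD, hTD⟩ := exists_ae_eq_snd_preimage β hT
    rw [setLIntegral_congr hTD, setLIntegral_congr hTD, hA hD hB,
      ← setLIntegral_map hD hfm measurable_snd, hsnd,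
      setLIntegral_map hD hfm measurable_transpose]
    rfl
  have hνp : IsProbabilityMeasure ((sampleLaw β).map ν) :=
    Measure.isProbabilityMeasure_map hν.aemeasurable
  refine ext_of_map_coords ?_
  have hft : Measurable fun c : ℕ → ℕ → A => freqs (transpose c) :=
    measurable_freqs.comp measurable_transpose
  rw [Measure.map_map measurable_coords hν,
    show (sampleLaw β).map (coords (ℕ → A) ∘ ν) = _ from Measure.map_congr hcoords,
    ← Function.comp_def (fun c => freqs (transpose c)) Prod.snd,
    ← Measure.map_map hft measurable_snd, hsnd, Measure.map_map hft measurable_transpose]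
  ext T hT
  rw [Measure.map_apply (hft.comp measurable_transpose) hT,
    Measure.map_apply measurable_coords hT]
  change rowLaw Q (freqs ⁻¹' T) = _
  rw [rowLaw, Measure.bind_apply (measurable_freqs hT) (Kernel.measurable _).aemeasurable,
    ← lintegral_indicator_one (measurable_coords hT)]
  refine lintegral_congr fun m => ?_
  have h : (freqs ⁻¹' T : Set (ℕ → ℕ → A))
      =ᵐ[Measure.infinitePi fun _ : ℕ => (m : Measure (ℕ → A))] {_r | coords (ℕ → A) m ∈ T} := by
    filter_upwards [freqs_ae_eq m] with r hr
    change (freqs r ∈ T) = (coords (ℕ → A) m ∈ T)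
    rw [hr]
  -- Under rows sampled from `m`, the frequencies are almost surely the constant `coords (ℕ → A) m`,
  -- so the event has probability 0 or 1.
  change Measure.infinitePi (fun _ : ℕ => (m : Measure (ℕ → A))) _ = _
  rw [measure_congr h]
  by_cases hm : coords (ℕ → A) m ∈ T <;> simp [hm]

end Mixture

/-! ### Exchangeability of the factors -/

section Exchangeability

variable {A : Type*} [MeasurableSpace A]

theorem measurable_BSpace_mk {X : Type*} [MeasurableSpace X] {h : X → I01 → ProbabilityMeasure A}
    (hh : Measurable fun p : X × I01 => h p.1 p.2) :
    Measurable fun x => BSpace.mk (h x) (hh.comp measurable_prodMk_left) := by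
  rw [measurable_iff_comap_le, instMeasurableSpaceBSpace]
  simp only [MeasurableSpace.comap_iSup, MeasurableSpace.comap_comp]
  refine iSup_le fun φ => iSup_le fun hφ => iSup_le fun s => iSup_le fun hs => ?_
  rw [← measurable_iff_comap_le]
  change Measurable fun x => ∫ t, φ t * (h x t : Measure A).real s ∂leb
  -- An element of `L^∞` is only a.e. strongly measurable, so `φ` is replaced by a measurable
  -- version, which leaves the integrals unchanged.
  have hm : Measurable fun p : X × I01 => hφ.1.mk φ p.2 * (h p.1 p.2 : Measure A).real s :=
    (hφ.1.stronglyMeasurable_mk.measurable.comp measurable_snd).mul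
      (((Measure.measurable_coe hs).comp (measurable_subtype_coe.comp hh)).ennreal_toReal)
  have h1 : ∀ x, ∫ t, φ t * (h x t : Measure A).real s ∂leb =
      ∫ t, hφ.1.mk φ t * (h x t : Measure A).real s ∂leb := fun x =>
    integral_congr_ae (hφ.1.ae_eq_mk.mono fun t ht => by simp only [ht])
  simp only [h1]
  exact hm.stronglyMeasurable.integral_prod_right'.measurable

/-- Given the random measure the sample is i.i.d., so permuting it preserves the joint law. It
serves both for the classes and for the values at a fixed `t`. -/
theorem isExchangeableSeq_of_map_eq_sampleLaw {Ω C E : Type*} [MeasurableSpace Ω]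
    [MeasurableSpace C] [MeasurableSpace E] {P : Measure Ω} {β : Measure (ProbabilityMeasure C)}
    [IsProbabilityMeasure β] {e : Ω → ProbabilityMeasure C × (ℕ → C)} (he : Measurable e)
    (hP : P.map e = sampleLaw β) {Y : ProbabilityMeasure C × C → E} (hY : Measurable Y) :
    IsExchangeableSeq P fun i ω => Y ((e ω).1, (e ω).2 i) := by
  have hH : Measurable fun (q : ProbabilityMeasure C × (ℕ → C)) i => Y (q.1, q.2 i) :=
    measurable_pi_lambda _ fun i => hY.comp (by fun_prop)
  refine ⟨fun i => hY.comp (by fun_prop), fun σ _ => ?_⟩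
  have h1 := hH.comp (measurable_permuteSample σ)
  refine ⟨(h1.comp he).aemeasurable, (hH.comp he).aemeasurable, ?_⟩
  have h2 := Measure.map_map (μ := P) h1 he
  have h3 := Measure.map_map (μ := P) hH he
  rw [hP] at h2 h3
  rw [← Measure.map_map hH (measurable_permuteSample σ), sampleLaw_map_permuteSample] at h2
  exact h2.symm.trans h3

end Exchangeability

/-! ### Reduction of the universe level -/

section Small

universe u

theorem small_of_standardBorel (A : Type u) [MeasurableSpace A] [StandardBorelSpace A] :
    Small.{0} A :=
  small_of_injective (measurableEmbedding_embeddingReal A).injective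

instance small_probabilityMeasure (C : Type u) [MeasurableSpace C] [Small.{0} C] :
    Small.{0} (ProbabilityMeasure C) := by
  refine small_of_injective (β := Set C → ℝ≥0∞) (f := fun m s => (m : Measure C) s) fun m m' h => ?_
  exact Subtype.ext (Measure.ext fun s _ => congrFun h s)

/-- The natural sample space lives in the universe of `A`. It is small, as `A` embeds in `ℝ` and a
measure is determined by its values on sets, so it has a copy in `Type`. -/
theorem exists_type_zero_model {X : Type u} [MeasurableSpace X] [Small.{0} X] (P : Measure X)
    [IsProbabilityMeasure P] :
    ∃ (Ω : Type) (_ : MeasurableSpace Ω) (P' : Measure Ω) (_ : IsProbabilityMeasure P')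
      (e : Ω → X), Measurable e ∧ P'.map e = P := by
  let _ : MeasurableSpace (Shrink.{0} X) := MeasurableSpace.comap (equivShrink X).symm inferInstance
  have he : Measurable (equivShrink X).symm := comap_measurable _
  have hs : Measurable (equivShrink X) := by
    rw [measurable_comap_iff, Equiv.symm_comp_self]
    exact measurable_id
  refine ⟨Shrink.{0} X, inferInstance, P.map (equivShrink X),
    Measure.isProbabilityMeasure_map hs.aemeasurable, (equivShrink X).symm, he, ?_⟩
  rw [Measure.map_map he hs]
  simp

end Small

end ERM

theorem theoremB {A : Type*} [MeasurableSpace A] [StandardBorelSpace A]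
    {Ω : Type*} [MeasurableSpace Ω] (P : Measure Ω) [IsProbabilityMeasure P]
    (μ : Ω → ProbabilityMeasure (ℕ → A)) (hμ : ERM.IsERM P μ) :
    ∃ (Ω' : Type) (_ : MeasurableSpace Ω') (P' : Measure Ω') (_ : IsProbabilityMeasure P')
      (l : ℕ → Ω' → ERM.BSpace A),
      ERM.IsExchangeableSeq P' l ∧
      IdentDistrib μ (fun ω => ERM.mixProd fun i => l i ω) P P' ∧
      ∃ (f : ℕ → Ω' → ERM.I01 → ProbabilityMeasure A)
        (hf : ∀ i, Measurable fun p : Ω' × ERM.I01 => f i p.1 p.2),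
        (∀ i ω, l i ω = ERM.BSpace.mk (f i ω) ((hf i).comp measurable_prodMk_left)) ∧
        ∀ t, ERM.IsERPM P' fun ω => ERM.prodMeasure fun i => f i ω t := by
  obtain ⟨hμm, hμσ⟩ := hμ
  -- `A` is nonempty because `A^ℕ` carries a probability measure.
  obtain ⟨ω₀⟩ := nonempty_of_isProbabilityMeasure P
  obtain ⟨x₀⟩ := nonempty_of_isProbabilityMeasure (μ ω₀ : Measure (ℕ → A))
  have : Nonempty A := ⟨x₀ 0⟩
  have : IsProbabilityMeasure (P.map μ) := Measure.isProbabilityMeasure_map hμm.aemeasurable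
  obtain ⟨β, _, g, hg, hQ⟩ := ERM.exists_mixture (P.map μ) fun σ hσ => by
    rw [Measure.map_map (ERM.measurable_map_permute σ) hμm]
    exact (hμσ σ hσ).map_eq.symm
  have := ERM.small_of_standardBorel A
  obtain ⟨Ω', _, P', _, e, he, hP⟩ := ERM.exists_type_zero_model (ERM.sampleLaw β)
  have hf : ∀ i, Measurable fun p : Ω' × ERM.I01 => g (e p.1).1 p.2 ((e p.1).2 i) := fun i =>
    hg.comp (by fun_prop : Measurable fun p : Ω' × ERM.I01 => ((e p.1).1, p.2, (e p.1).2 i))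
  have hY : Measurable fun q : (ProbabilityMeasure (ℕ → A) × (ℕ → A)) × ERM.I01 =>
      g q.1.1 q.2 q.1.2 := hg.comp (by fun_prop :
        Measurable fun q : (ProbabilityMeasure (ℕ → A) × (ℕ → A)) × ERM.I01 =>
          (q.1.1, q.2, q.1.2))
  have hν := ERM.measurable_mixProdFun
    (f := fun i (ω : ProbabilityMeasure (ℕ → A) × (ℕ → ℕ → A)) t => g ω.1 t (ω.2 i)) fun i => hg.comp (by fun_prop :
      Measurable fun p : (ProbabilityMeasure (ℕ → A) × (ℕ → ℕ → A)) × ERM.I01 =>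
        (p.1.1, p.2, p.1.2 i))
  refine ⟨Ω', inferInstance, P', inferInstance, fun i ω => ERM.BSpace.mk
      (fun t => g (e ω).1 t ((e ω).2 i)) ((hf i).comp measurable_prodMk_left),
    ERM.isExchangeableSeq_of_map_eq_sampleLaw he hP 
      (ERM.measurable_BSpace_mk (h := fun q t => g q.1 t q.2) hY), ?_,
    fun i ω t => g (e ω).1 t ((e ω).2 i), hf, fun _ _ => rfl, fun t =>
      ⟨fun i ω => g (e ω).1 t ((e ω).2 i), ERM.isExchangeableSeq_of_map_eq_sampleLaw he hP
        (Y := fun q => g q.1 t q.2) (hY.comp measurable_prodMk_right), fun _ => rfl⟩⟩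
  simp only [ERM.mixProd_mk]
  refine ⟨hμm.aemeasurable, (hν.comp he).aemeasurable, ?_⟩
  have h := Measure.map_map (μ := P') hν he
  rw [hP, hQ] at h
  exact h
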